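/- Let $\Bbbk$ be an algebraically closed field of characteristic $0$. For $d\ge 0$ let $V_d=\Bbbk[x,y]_d$ be the space of binary forms of degree $d$, with the action of $\mathrm{SL}_2=\mathrm{SL}_2(\Bbbk)$ given by $(gf)(v)=f(g^{-1}v)$, and let $\mathfrak{sl}_2$ be the space of trace-zero $2\times 2$ matrices with the adjoint action $gA=gAg^{-1}$. For a representation $V$ of $\mathrm{SL}_2$ and $i\in\mathbb N$ let $$V[i]=\Bigl\{v\in V \;\Bigm|\; \begin{bmatrix} t&0\\0&t^{-1}\end{bmatrix}v=t^{i}v\ \text{ for all } t\in\Bbbk^{*}\Bigr\}.$$ A covariant $\varphi\colon V\to W$ between finite-dimensional representations is an $\mathrm{SL}_2$-equivariant polynomial map; it is homogeneous of degree $n$ if $\varphi(cv)=c^n\varphi(v)$ for all $c\in\Bbbk$ and $v\in V$, and it is quadratic if it is homogeneous of degree $2$. 1. If $d$ is odd, then there is a quadratic covariant $\varphi_0\colon V_d\to\mathfrak{sl}_2$ such that $\varphi_0(V_d[1])=\mathfrak{sl}_2[2]=\Bbbk\begin{bmatrix}0&1\\0&0\end{bmatrix}$. 2. If $d\ge 2$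 is even, then there is a quadratic covariant $\varphi_0\colon V_d\to\mathfrak{sl}_2\otimes\mathfrak{sl}_2$ such that $\varphi_0(V_d[2])=\mathfrak{sl}_2[2]\otimes\mathfrak{sl}_2[2]$. 3. If $d\equiv 0 \bmod 4$, then there is a nonzero quadratic covariant $\psi\colon V_d\to V_d$ such that $\psi(V_d[2])=V_d[4]$. 4. If $d\equiv 2\bmod 4$ and $d\ge 10$, then there is a covariant $\psi\colon V_d\to V_d$, homogeneous of degree $4$, such that $\psi(V_d[2])=V_d[8]$, and there is no nonzero quadratic covariant $V_d\to V_d$. -/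

import Mathlib

open scoped TensorProduct MatrixGroups

noncomputable section

namespace SL2Covariants

section Morphisms

variable {k : Type*} [Field k] {V W : Type*} [AddCommGroup V] [Module k V]
  [AddCommGroup W] [Module k W]

/-- The coordinate ring `𝒪(V)` of a finite-dimensional vector space `V` over an infinite field:
the algebra of functions on `V` generated by the linear forms. -/
def regularFunctions (k V : Type*) [Field k] [AddCommGroup V] [Module k V] :
    Subalgebra k (V → k) :=
  Algebra.adjoin k {f | ∃ l : Module.Dual k V, f = fun v => l v}

/-- A morphism (polynomial map) `V → W` of finite-dimensional vector spaces: every linear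
coordinate function of `W` pulls back to a regular function on `V`. -/
def IsMorphism (k : Type*) [Field k] {V W : Type*} [AddCommGroup V] [Module k V]
    [AddCommGroup W] [Module k W] (φ : V → W) : Prop :=
  ∀ l : Module.Dual k W, (fun v => l (φ v)) ∈ regularFunctions k V

/-- A covariant between two representations: an equivariant morphism. -/
structure IsCovariant {G : Type*} [Monoid G] (ρ : Representation k G V)
    (σ : Representation k G W) (φ : V → W) : Prop where
  isMorphism : IsMorphism k φ
  equivariant : ∀ g v, φ (ρ g v) = σ g (φ v)

/-- A covariant which is homogeneous of degree `n` (the zero map is homogeneous of every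
degree). A quadratic covariant is a homogeneous covariant of degree `2`. -/
structure IsHomogeneousCovariant {G : Type*} [Monoid G] (n : ℕ) (ρ : Representation k G V)
    (σ : Representation k G W) (φ : V → W) : Prop extends IsCovariant ρ σ φ where
  homogeneous : ∀ (c : k) (v : V), φ (c • v) = c ^ n • φ v

end Morphisms

section Weights

variable {k : Type*} [Field k] {V : Type*} [AddCommGroup V] [Module k V]

/-- The element `diag(t, t⁻¹)` of the diagonal torus of `SL₂`. -/
def torus (t : kˣ) : SL(2, k) :=
  ⟨!![(t : k), 0; 0, ((t⁻¹ : kˣ) : k)], by simp [Matrix.det_fin_two]⟩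

/-- The weight space `V[i] = {v | diag(t, t⁻¹) v = tⁱ v for all t ∈ kˣ}`. -/
def weightSpace (ρ : Representation k SL(2, k) V) (i : ℕ) : Submodule k V where
  carrier := {v | ∀ t : kˣ, ρ (torus t) v = (t : k) ^ i • v}
  add_mem' := fun {a b} ha hb t => by rw [map_add, ha t, hb t, smul_add]
  zero_mem' := fun t => by simp
  smul_mem' := fun c v hv t => by rw [map_smul, hv t, smul_comm]

end Weights

section BinaryForms

variable (k : Type*) [Field k]

/-- The substitution `f(v) ↦ f(A v)` on `k[x, y]`, with `x = X 0` and `y = X 1`. -/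
def linSubst (A : Matrix (Fin 2) (Fin 2) k) :
    MvPolynomial (Fin 2) k →ₐ[k] MvPolynomial (Fin 2) k :=
  MvPolynomial.aeval fun i => ∑ j, MvPolynomial.C (A i j) * MvPolynomial.X j

theorem linSubst_one : linSubst k 1 = AlgHom.id k _ := by
  ext1 i
  fin_cases i <;> simp [linSubst]

theorem linSubst_mul (A B : Matrix (Fin 2) (Fin 2) k) :
    linSubst k (A * B) = (linSubst k B).comp (linSubst k A) := by
  ext1 i
  simp [linSubst, Matrix.mul_apply]
  ring

theorem eval_linSubst (A : Matrix (Fin 2) (Fin 2) k) (v : Fin 2 → k)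
    (f : MvPolynomial (Fin 2) k) :
    MvPolynomial.eval v (linSubst k A f) = MvPolynomial.eval (A.mulVec v) f := by
  induction f using MvPolynomial.induction_on with
  | C a => simp [linSubst]
  | add p q hp hq => simp [hp, hq]
  | mul_X p i hp =>
    rw [map_mul, map_mul, hp, map_mul]
    congr 1
    simp only [linSubst, MvPolynomial.aeval_X, map_sum, map_mul, MvPolynomial.eval_C,
      MvPolynomial.eval_X]
    rfl

theorem linSubst_mem (A : Matrix (Fin 2) (Fin 2) k) {d : ℕ} {f : MvPolynomial (Fin 2) k}
    (hf : f ∈ MvPolynomial.homogeneousSubmodule (Fin 2) k d) :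
    linSubst k A f ∈ MvPolynomial.homogeneousSubmodule (Fin 2) k d := by
  rw [MvPolynomial.mem_homogeneousSubmodule] at hf ⊢
  have h := MvPolynomial.IsHomogeneous.aeval hf
    (fun i => ∑ j, MvPolynomial.C (A i j) * MvPolynomial.X (R := k) j) (n := 1) (fun i => by
      refine MvPolynomial.IsHomogeneous.sum _ _ _ fun j _ => ?_
      simpa using (MvPolynomial.isHomogeneous_C (Fin 2) (A i j)).mul
        (MvPolynomial.isHomogeneous_X k j))
  simpa [linSubst] using h

/-- The space `V_d = k[x, y]_d` of binary forms of degree `d`. -/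
abbrev BinaryForm (d : ℕ) : Type _ := MvPolynomial.homogeneousSubmodule (Fin 2) k d

/-- The representation of `SL₂` on binary forms of degree `d`, `(g f)(v) = f(g⁻¹ v)`. -/
def binaryFormRep (d : ℕ) : Representation k SL(2, k) (BinaryForm k d) where
  toFun g := (linSubst k ((g⁻¹ : SL(2, k)) : Matrix (Fin 2) (Fin 2) k)).toLinearMap.restrict
    fun _ hf => linSubst_mem k _ hf
  map_one' := by
    ext1 f
    apply Subtype.ext
    simp [LinearMap.restrict_apply, linSubst_one]
  map_mul' g h := by
    ext1 f
    apply Subtype.ext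
    have e : (((g * h)⁻¹ : SL(2, k)) : Matrix (Fin 2) (Fin 2) k) =
        ((h⁻¹ : SL(2, k)) : Matrix (Fin 2) (Fin 2) k) *
          ((g⁻¹ : SL(2, k)) : Matrix (Fin 2) (Fin 2) k) := by
      rw [mul_inv_rev, Matrix.SpecialLinearGroup.coe_mul]
    change linSubst k _ f.1 = linSubst k _ (linSubst k _ f.1)
    rw [e, linSubst_mul, AlgHom.comp_apply]

end BinaryForms

section Adjoint

variable (k : Type*) [Field k]

/-- The Lie algebra `sl₂` of trace-zero matrices. -/
abbrev sl2 : Type _ := LieAlgebra.SpecialLinear.sl (Fin 2) k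

theorem conj_mem_sl2 (g : SL(2, k)) (A : sl2 k) :
    (g : Matrix (Fin 2) (Fin 2) k) * (A : Matrix (Fin 2) (Fin 2) k) *
      ((g⁻¹ : SL(2, k)) : Matrix (Fin 2) (Fin 2) k) ∈
        LieAlgebra.SpecialLinear.sl (Fin 2) k := by
  have hA : Matrix.trace (A : Matrix (Fin 2) (Fin 2) k) = 0 := A.2
  have hg : ((g⁻¹ : SL(2, k)) : Matrix (Fin 2) (Fin 2) k) *
      (g : Matrix (Fin 2) (Fin 2) k) = 1 := by
    rw [← Matrix.SpecialLinearGroup.coe_mul, inv_mul_cancel, Matrix.SpecialLinearGroup.coe_one]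
  change Matrix.trace ((g : Matrix (Fin 2) (Fin 2) k) * (A : Matrix (Fin 2) (Fin 2) k) *
      ((g⁻¹ : SL(2, k)) : Matrix (Fin 2) (Fin 2) k)) = 0
  rw [Matrix.trace_mul_comm, ← mul_assoc, hg, one_mul, hA]

/-- The adjoint representation of `SL₂` on `sl₂`, `A ↦ g A g⁻¹`. -/
def adjointRep : Representation k SL(2, k) (sl2 k) where
  toFun g :=
    { toFun := fun A => ⟨(g : Matrix (Fin 2) (Fin 2) k) * (A : Matrix (Fin 2) (Fin 2) k) *
        ((g⁻¹ : SL(2, k)) : Matrix (Fin 2) (Fin 2) k), conj_mem_sl2 k g A⟩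
      map_add' := fun A B => Subtype.ext (by simp [mul_add, add_mul])
      map_smul' := fun c A => Subtype.ext (by simp) }
  map_one' := by
    ext1 A
    apply Subtype.ext
    simp
  map_mul' g h := by
    ext1 A
    apply Subtype.ext
    simp only [Module.End.mul_apply, LinearMap.coe_mk, AddHom.coe_mk, mul_inv_rev,
      Matrix.SpecialLinearGroup.coe_mul, mul_assoc]

/-- The matrix `!![0, 1; 0, 0]` as an element of `sl₂`. -/
def sl2E : sl2 k :=
  ⟨!![0, 1; 0, 0], by
    change Matrix.trace (!![0, 1; 0, 0] : Matrix (Fin 2) (Fin 2) k) = 0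
    simp [Matrix.trace_fin_two]⟩

end Adjoint

end SL2Covariants

end

/-! Torus weights make each space `V_d[i]` with `i ≤ d`, `i ≡ d mod 2`, a line, spanned by `x ^ a *
y ^ b` with `b - a = i`; `y` has positive weight because `g` acts through `g⁻¹`. Over an
algebraically closed field a homogeneous map of positive degree that is nonzero at a generator and
sends it into a line covers that line (`image_span_singleton`). So every existence claim reduces to
an equivariant construction and a nonzero value at one monomial.

The constructions come from Cayley's operator Ω, which commutes with `SL₂`. For `d = 2m + 1`, the
transvectant `(f, f)_{2m}` is a quadratic form, hence an element of `sl₂`. For even `d`, `Ω ^ (d -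
2)` sends `f ⊗ f` to `V_2 ⊗ V_2`. For `d = 4s` take `(f, f)_{2s}`. For `d = 4n + 2` take the
Jacobian of `(f, f)_{2n+2}` and `(f, f)_{4n}`. An even transvectant of a monomial with itself is a
monomial times an alternating sum of Dixon type, nonzero by `sum_dixonTerm_ne_zero`.

For nonexistence, polarize to a symmetric equivariant `B`. The vector `B (x ^ d) (y ^ d)` has weight
zero, so it is a multiple of `(x * y) ^ (d / 2)`. The Weyl element exchanges `x ^ d` and `y ^ d` but
negates this monomial when `d / 2` is odd, so the value is zero. Moving the pair `x, y` by `SL₂` and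
scaling gives `B = 0` on pairs of powers of independent linear forms, and such powers span. -/

noncomputable section

namespace SL2Covariants

open MvPolynomial TensorProduct

/-! ### Cayley's operator and transvectants -/

section Transvectants

variable (k : Type*) [Field k]

/-- The partial derivative on `k[x, y]` as a linear endomorphism. -/
def partialD (i : Fin 2) : Module.End k (MvPolynomial (Fin 2) k) :=
  (pderiv i).toLinearMap

variable {k}

theorem partialD_apply (i : Fin 2) (f : MvPolynomial (Fin 2) k) :
    partialD k i f = pderiv i f := rfl

theorem partialD_commute (i j : Fin 2) : Commute (partialD k i) (partialD k j) := by
  refine LinearMap.ext fun f => ?_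
  -- The commutator of two derivations is a derivation, so it suffices that it kills the variables.
  have h : ⁅(pderiv i : Derivation k (MvPolynomial (Fin 2) k) (MvPolynomial (Fin 2) k)),
      (pderiv j : Derivation k (MvPolynomial (Fin 2) k) (MvPolynomial (Fin 2) k))⁆ = 0 := by
    refine MvPolynomial.derivation_ext fun l => ?_
    rw [Derivation.commutator_apply]
    simp only [pderiv_X, Pi.single_apply, Derivation.coe_zero, Pi.zero_apply]
    split_ifs <;> simp
  have h' := congrArg (fun D => D f) h
  simp only [Derivation.commutator_apply, Derivation.coe_zero, Pi.zero_apply] at h'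
  exact sub_eq_zero.mp h'

/-- The chain rule for linear substitutions. -/
theorem partialD_linSubst (A : Matrix (Fin 2) (Fin 2) k) (i : Fin 2)
    (f : MvPolynomial (Fin 2) k) :
    partialD k i (linSubst k A f) = ∑ j, A j i • linSubst k A (partialD k j f) := by
  simp only [partialD_apply]
  induction f using MvPolynomial.induction_on with
  | C a => simp [linSubst]
  | add p q hp hq => simp [hp, hq, Finset.sum_add_distrib]
  | mul_X p n hp =>
    have hX : pderiv i (linSubst k A (X n)) = C (A n i) := by
      simp only [linSubst, aeval_X, map_sum, pderiv_C_mul, pderiv_X, Pi.single_apply]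
      simp
    rw [map_mul, pderiv_mul, hp, hX]
    simp only [pderiv_mul, pderiv_X, map_add, map_mul, Fin.sum_univ_two, smul_eq_C_mul]
    fin_cases n <;> simp <;> ring

theorem isHomogeneous_partialD_pow {n : ℕ} {f : MvPolynomial (Fin 2) k} (hf : f.IsHomogeneous n)
    (i : Fin 2) (r : ℕ) : ((partialD k i ^ r) f).IsHomogeneous (n - r) := by
  induction r with
  | zero => simpa using hf
  | succ r ih =>
    rw [pow_succ', Module.End.mul_apply, ← Nat.sub_sub]
    exact ih.pderiv

variable (k) in
/-- Cayley's operator `∂x ⊗ ∂y - ∂y ⊗ ∂x`. -/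
def omega : Module.End k (MvPolynomial (Fin 2) k ⊗[k] MvPolynomial (Fin 2) k) :=
  TensorProduct.map (partialD k 0) (partialD k 1) - TensorProduct.map (partialD k 1) (partialD k 0)

/-- By the chain rule Ω is a 2 × 2 determinant in the partial derivatives, hence a relative
invariant of weight `det`; on `SL₂` it is invariant. -/
theorem omega_map_linSubst (A : Matrix (Fin 2) (Fin 2) k) :
    omega k * TensorProduct.map (linSubst k A).toLinearMap (linSubst k A).toLinearMap =
      A.det • (TensorProduct.map (linSubst k A).toLinearMap (linSubst k A).toLinearMap *
        omega k) := by
  refine TensorProduct.ext' fun f g => ?_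
  simp only [omega, Module.End.mul_apply, LinearMap.sub_apply, TensorProduct.map_tmul,
    AlgHom.toLinearMap_apply, partialD_linSubst, Fin.sum_univ_two, LinearMap.smul_apply, map_sub,
    Matrix.det_fin_two, TensorProduct.add_tmul, TensorProduct.tmul_add, TensorProduct.tmul_smul,
    ← TensorProduct.smul_tmul']
  module

theorem omega_pow_map_linSubst {A : Matrix (Fin 2) (Fin 2) k} (hA : A.det = 1) (r : ℕ) :
    omega k ^ r * TensorProduct.map (linSubst k A).toLinearMap (linSubst k A).toLinearMap =
      TensorProduct.map (linSubst k A).toLinearMap (linSubst k A).toLinearMap * omega k ^ r := by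
  have h : Commute (omega k)
      (TensorProduct.map (linSubst k A).toLinearMap (linSubst k A).toLinearMap) := by
    have := omega_map_linSubst A
    rwa [hA, one_smul] at this
  exact h.pow_left r

/-- The two summands of Ω commute, so the binomial theorem applies. -/
theorem omega_pow_tmul (r : ℕ) (f g : MvPolynomial (Fin 2) k) :
    (omega k ^ r) (f ⊗ₜ g) = ∑ i ∈ Finset.range (r + 1),
      ((-1) ^ (r - i) * (r.choose i : k)) •
        ((partialD k 0 ^ i * partialD k 1 ^ (r - i)) f ⊗ₜ[k]
          (partialD k 0 ^ (r - i) * partialD k 1 ^ i) g) := by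
  have homega : omega k = TensorProduct.map (partialD k 0) (partialD k 1) +
      (-1 : k) • TensorProduct.map (partialD k 1) (partialD k 0) := by
    refine TensorProduct.ext' fun f g => ?_
    simp only [omega, LinearMap.sub_apply, LinearMap.add_apply, LinearMap.smul_apply]
    module
  have hc : Commute (TensorProduct.map (partialD k 0) (partialD k 1))
      ((-1 : k) • TensorProduct.map (partialD k 1) (partialD k 0)) := by
    refine Commute.smul_right ?_ _
    rw [Commute, SemiconjBy, ← TensorProduct.map_mul, ← TensorProduct.map_mul,
      (partialD_commute (k := k) 0 1).eq]
  rw [homega, hc.add_pow, LinearMap.sum_apply]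
  refine Finset.sum_congr rfl fun i _ => ?_
  rw [smul_pow, TensorProduct.map_pow, TensorProduct.map_pow, ← (Nat.cast_commute _ _).eq,
    ((partialD_commute (k := k) 0 1).pow_pow (r - i) i).eq, ← nsmul_eq_mul]
  simp only [mul_smul_comm, ← TensorProduct.map_mul,
    LinearMap.smul_apply, TensorProduct.map_tmul, mul_smul]
  rw [← Nat.cast_smul_eq_nsmul k, smul_comm]

/-- The `r`-th transvectant of two binary forms. -/
def transvectant (r : ℕ) :
    MvPolynomial (Fin 2) k →ₗ[k] MvPolynomial (Fin 2) k →ₗ[k] MvPolynomial (Fin 2) k :=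
  (TensorProduct.mk k _ _).compr₂ (LinearMap.mul' k _ ∘ₗ omega k ^ r)

theorem transvectant_def (r : ℕ) (f g : MvPolynomial (Fin 2) k) :
    transvectant r f g = LinearMap.mul' k _ ((omega k ^ r) (f ⊗ₜ g)) := rfl

theorem transvectant_linSubst {A : Matrix (Fin 2) (Fin 2) k} (hA : A.det = 1) (r : ℕ)
    (f g : MvPolynomial (Fin 2) k) :
    transvectant r (linSubst k A f) (linSubst k A g) = linSubst k A (transvectant r f g) := by
  have h := congrArg (fun T => LinearMap.mul' k _ (T (f ⊗ₜ g))) (omega_pow_map_linSubst hA r)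
  have hmul : ∀ z, LinearMap.mul' k _ (TensorProduct.map (linSubst k A).toLinearMap
      (linSubst k A).toLinearMap z) = linSubst k A (LinearMap.mul' k _ z) := by
    intro z
    induction z using TensorProduct.induction_on with
    | zero => simp
    | tmul x y => simp
    | add x y hx hy => simp only [map_add, hx, hy]
  simpa only [Module.End.mul_apply, TensorProduct.map_tmul, AlgHom.toLinearMap_apply, hmul,
    ← transvectant_def] using h

theorem transvectant_apply (r : ℕ) (f g : MvPolynomial (Fin 2) k) :
    transvectant r f g = ∑ i ∈ Finset.range (r + 1),
      ((-1) ^ (r - i) * (r.choose i : k)) •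
        ((partialD k 0 ^ i * partialD k 1 ^ (r - i)) f *
          (partialD k 0 ^ (r - i) * partialD k 1 ^ i) g) := by
  simp only [transvectant_def, omega_pow_tmul, map_sum, map_smul, LinearMap.mul'_apply]

theorem isHomogeneous_transvectant {p q : ℕ} {f g : MvPolynomial (Fin 2) k}
    (hf : f.IsHomogeneous p) (hg : g.IsHomogeneous q) (r : ℕ) :
    (transvectant r f g).IsHomogeneous (p - r + (q - r)) := by
  rw [transvectant_apply]
  refine IsHomogeneous.sum _ _ _ fun i hi => ?_
  rw [smul_eq_C_mul]
  refine IsHomogeneous.C_mul (IsHomogeneous.mul ?_ ?_) _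
  · have h := isHomogeneous_partialD_pow (isHomogeneous_partialD_pow hf 1 (r - i)) 0 i
    rwa [Nat.sub_sub, Nat.sub_add_cancel (Finset.mem_range_succ_iff.mp hi)] at h
  · have h := isHomogeneous_partialD_pow (isHomogeneous_partialD_pow hg 1 i) 0 (r - i)
    rwa [Nat.sub_sub, Nat.add_sub_cancel' (Finset.mem_range_succ_iff.mp hi)] at h

end Transvectants

/-! ### Derivatives of monomials -/

section Monomials

variable (k : Type*) [Field k]

/-- The monomial `x ^ a * y ^ b`. -/
def binaryMonomial (a b : ℕ) : MvPolynomial (Fin 2) k := X 0 ^ a * X 1 ^ b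

theorem isHomogeneous_binaryMonomial (a b : ℕ) : (binaryMonomial k a b).IsHomogeneous (a + b) :=
  (isHomogeneous_X_pow 0 a).mul (isHomogeneous_X_pow 1 b)

variable {k}

theorem partialD_zero_pow_binaryMonomial (a b i : ℕ) :
    (partialD k 0 ^ i) (binaryMonomial k a b) =
      (a.descFactorial i : k) • binaryMonomial k (a - i) b := by
  induction i with
  | zero => simp
  | succ i ih =>
    rw [pow_succ', Module.End.mul_apply, ih, map_smul, partialD_apply, binaryMonomial, pderiv_mul,
      pderiv_pow, pderiv_pow, pderiv_X_self, pderiv_X_of_ne (by decide), Nat.descFactorial_succ,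
      Nat.sub_sub]
    simp only [binaryMonomial, smul_eq_C_mul, Nat.cast_mul, map_mul, map_natCast]
    ring

theorem partialD_one_pow_binaryMonomial (a b i : ℕ) :
    (partialD k 1 ^ i) (binaryMonomial k a b) =
      (b.descFactorial i : k) • binaryMonomial k a (b - i) := by
  induction i with
  | zero => simp
  | succ i ih =>
    rw [pow_succ', Module.End.mul_apply, ih, map_smul, partialD_apply, binaryMonomial, pderiv_mul,
      pderiv_pow, pderiv_pow, pderiv_X_self, pderiv_X_of_ne (by decide), Nat.descFactorial_succ,
      Nat.sub_sub]
    simp only [binaryMonomial, smul_eq_C_mul, Nat.cast_mul, map_mul, map_natCast]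
    ring

theorem partialD_mul_binaryMonomial (a b i j : ℕ) :
    (partialD k 0 ^ i * partialD k 1 ^ j) (binaryMonomial k a b) =
      ((a.descFactorial i : k) * (b.descFactorial j : k)) • binaryMonomial k (a - i) (b - j) := by
  rw [Module.End.mul_apply, partialD_one_pow_binaryMonomial, map_smul,
    partialD_zero_pow_binaryMonomial, smul_smul, mul_comm]

end Monomials

/-! ### Nonvanishing of a Dixon-type alternating sum -/

section Dixon

/-- The coefficient occurring in the transvectant of order `2 * s` of `x ^ p * y ^ q` with
itself. -/
def dixonTerm (s p q i : ℕ) : ℤ :=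
  (-1) ^ i * (2 * s).choose i * (p.descFactorial i * p.descFactorial (2 * s - i)) *
    (q.descFactorial i * q.descFactorial (2 * s - i))

theorem cast_descFactorial_succ (n i : ℕ) :
    (n.descFactorial (i + 1) : ℤ) = (n - i) * n.descFactorial i := by
  rw [Nat.descFactorial_succ]
  rcases le_or_gt i n with h | h
  · push_cast [h]; ring
  · rw [Nat.descFactorial_of_lt h]; simp

theorem cast_succ_descFactorial (n i : ℕ) :
    ((n : ℤ) + 1 - i) * ((n + 1).descFactorial i : ℤ) = (n + 1) * n.descFactorial i := by
  have h := cast_descFactorial_succ (n + 1) i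
  rw [Nat.succ_descFactorial_succ] at h
  push_cast at h
  linarith

theorem dixonTerm_succ_right (s p q i : ℕ) (hi : i ≤ 2 * s) :
    ((q : ℤ) + 1 - i) * (q + 1 - (2 * s - i)) * dixonTerm s p (q + 1) i =
      (q + 1) ^ 2 * dixonTerm s p q i := by
  have h1 := cast_succ_descFactorial q i
  have h2 := cast_succ_descFactorial q (2 * s - i)
  push_cast [hi] at h2
  unfold dixonTerm
  linear_combination (-1) ^ i * ((2 * s).choose i : ℤ) *
    (p.descFactorial i * p.descFactorial (2 * s - i)) *
    (((q : ℤ) + 1 - i) * (q + 1).descFactorial i * h2 +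
      (q + 1) * q.descFactorial (2 * s - i) * h1)

theorem dixonTerm_succ (s p q i : ℕ) (hi : i ≤ 2 * s) :
    ((i : ℤ) + 1) * (p - 2 * s + i + 1) * (q - 2 * s + i + 1) * dixonTerm s p q (i + 1) =
      -((2 * s - i) * (p - i) * (q - i) * dixonTerm s p q i) := by
  rcases hi.lt_or_eq with h | h
  · obtain ⟨j, hj⟩ : ∃ j, 2 * s = i + 1 + j := ⟨2 * s - (i + 1), by omega⟩
    have hj' : (2 * s : ℤ) = i + 1 + j := by exact_mod_cast hj
    have e1 : 2 * s - i = j + 1 := by omega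
    have e2 : 2 * s - (i + 1) = j := by omega
    have h1 := Nat.choose_succ_right_eq (2 * s) i
    rw [e1] at h1
    have h1' : ((2 * s).choose (i + 1) : ℤ) * (i + 1) = (2 * s).choose i * (j + 1) := by
      exact_mod_cast h1
    unfold dixonTerm
    rw [e1, e2, hj']
    simp only [cast_descFactorial_succ, pow_succ]
    linear_combination (-1) ^ (i + 1) * ((p : ℤ) - j) * (q - j) * (p - i) * (q - i) *
      p.descFactorial i * p.descFactorial j * q.descFactorial i * q.descFactorial j * h1'
  · have : (2 * s : ℤ) = i := by exact_mod_cast h.symm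
    rw [this]
    simp [dixonTerm, h]

/-- Creative telescoping in `q`: the difference of the two summands, after multiplication by `2 * (q
+ 1)`, is a difference of consecutive values of an explicit multiple of `dixonTerm s (s + b) (q + 1)
i`. That multiple vanishes at both ends, through the factor `i` at `0` and the binomial coefficient
at `2 * s + 1`. -/
theorem sum_dixonTerm_succ (s b q : ℕ) :
    ((q : ℤ) + 1 - s) * (b + (q + 1 - s)) *
        ∑ i ∈ Finset.range (2 * s + 1), dixonTerm s (s + b) (q + 1) i =
      (q + 1) * (b + (q + 1)) * ∑ i ∈ Finset.range (2 * s + 1), dixonTerm s (s + b) q i := by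
  have key : ∀ i ∈ Finset.range (2 * s + 1),
      (((q : ℤ) + 1 - s) * (b + (q + 1 - s)) * dixonTerm s (s + b) (q + 1) i * (q + 1) -
        (q + 1) * (b + (q + 1)) * dixonTerm s (s + b) q i * (q + 1)) * 2 =
      -(((i + 1 : ℕ) : ℤ) * (b - s + ((i + 1 : ℕ) : ℤ)) * (q + 1 - 2 * s + ((i + 1 : ℕ) : ℤ)) *
        dixonTerm s (s + b) (q + 1) (i + 1)) -
      -((i : ℤ) * (b - s + i) * (q + 1 - 2 * s + i) * dixonTerm s (s + b) (q + 1) i) := by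
    intro i hi
    have hi' := Finset.mem_range_succ_iff.mp hi
    have h1 := dixonTerm_succ_right s (s + b) q i hi'
    have h2 := dixonTerm_succ s (s + b) (q + 1) i hi'
    push_cast at h2 ⊢
    linear_combination 2 * (b + (q + 1 : ℤ)) * h1 + h2
  have hs := Finset.sum_congr rfl key
  rw [Finset.sum_range_sub (fun i : ℕ => -((i : ℤ) * (b - s + i) * (q + 1 - 2 * s + i) *
        dixonTerm s (s + b) (q + 1) i))] at hs
  have hz : dixonTerm s (s + b) (q + 1) (2 * s + 1) = 0 := by simp [dixonTerm]
  rw [hz, ← Finset.sum_mul, Finset.sum_sub_distrib, ← Finset.sum_mul, ← Finset.sum_mul,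
    ← Finset.mul_sum, ← Finset.mul_sum] at hs
  have hq : ((q : ℤ) + 1) ≠ 0 := by positivity
  refine mul_right_cancel₀ hq ?_
  simp only [mul_zero, neg_zero, Nat.cast_zero, zero_mul, sub_zero] at hs
  linarith

/-- A form of Dixon's identity: the alternating sum does not vanish. -/
theorem sum_dixonTerm_ne_zero {s p q : ℕ} (hp : s ≤ p) (hq : s ≤ q) :
    ∑ i ∈ Finset.range (2 * s + 1), dixonTerm s p q i ≠ 0 := by
  obtain ⟨b, rfl⟩ := Nat.exists_eq_add_of_le hp
  induction q, hq using Nat.le_induction with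
  | base =>
    -- For `q = s` a nonzero term needs both `i ≤ s` and `2 * s - i ≤ s`, so only `i = s` survives.
    rw [Finset.sum_eq_single s]
    · have e : 2 * s - s = s := by omega
      have h1 := (Nat.choose_pos (n := 2 * s) (k := s) (by omega)).ne'
      have h2 := (Nat.descFactorial_pos.mpr hp).ne'
      have h3 := (Nat.descFactorial_pos.mpr (le_refl s)).ne'
      simp only [dixonTerm, e]
      have : ((-1 : ℤ) ^ s) ≠ 0 := by simp
      simp only [ne_eq, mul_eq_zero, Nat.cast_eq_zero, this, h1, h2, h3, or_self, not_false_eq_true]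
    · intro i _ hi
      rcases lt_or_gt_of_ne hi with h | h
      · simp [dixonTerm, Nat.descFactorial_of_lt (show s < 2 * s - i by omega)]
      · simp [dixonTerm, Nat.descFactorial_of_lt h]
    · intro h
      exact absurd (Finset.mem_range.mpr (by omega)) h
  | succ q hq ih =>
    intro h
    have h1 := sum_dixonTerm_succ s b q
    rw [h, mul_zero] at h1
    have : ((q : ℤ) + 1) * (b + (q + 1)) ≠ 0 := by positivity
    exact mul_ne_zero this ih h1.symm

end Dixon

/-! ### Even self-transvectants of monomials -/

section TransvectantOfMonomials

variable {k : Type*} [Field k] [CharZero k]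

theorem transvectant_binaryMonomial_self {s p q : ℕ} (hp : s ≤ p) (hq : s ≤ q) :
    ∃ u : k, u ≠ 0 ∧
      transvectant (2 * s) (binaryMonomial k p q) (binaryMonomial k p q) =
        u • binaryMonomial k (2 * p - 2 * s) (2 * q - 2 * s) := by
  refine ⟨((∑ i ∈ Finset.range (2 * s + 1), dixonTerm s p q i : ℤ) : k),
    Int.cast_ne_zero.mpr (sum_dixonTerm_ne_zero hp hq), ?_⟩
  rw [transvectant_apply, Int.cast_sum, Finset.sum_smul]
  refine Finset.sum_congr rfl fun i hi => ?_
  have hi' := Finset.mem_range_succ_iff.mp hi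
  rw [partialD_mul_binaryMonomial, partialD_mul_binaryMonomial, smul_mul_smul_comm, smul_smul]
  have hsign : (-1 : k) ^ (2 * s - i) = (-1) ^ i := by
    obtain ⟨j, hj⟩ := Nat.exists_eq_add_of_le hi'
    have : (-1 : k) ^ i * (-1) ^ j = 1 := by rw [← pow_add, ← hj, pow_mul]; simp
    rw [hj, Nat.add_sub_cancel_left]
    rcases neg_one_pow_eq_or k i with h | h <;> rw [h] at this ⊢
    · linear_combination this
    · linear_combination -this
  have hcoef : ((dixonTerm s p q i : ℤ) : k) = (-1) ^ (2 * s - i) * ((2 * s).choose i : k) *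
      ((p.descFactorial i : k) * (q.descFactorial (2 * s - i) : k) *
        ((p.descFactorial (2 * s - i) : k) * (q.descFactorial i : k))) := by
    rw [hsign, dixonTerm]
    push_cast
    ring
  rw [← hcoef]
  by_cases hz : dixonTerm s p q i = 0
  · simp [hz]
  · have hle : i ≤ p ∧ 2 * s - i ≤ p ∧ i ≤ q ∧ 2 * s - i ≤ q := by
      simp only [dixonTerm, mul_eq_zero, Nat.cast_eq_zero, Nat.descFactorial_eq_zero_iff_lt] at hz
      omega
    congr 1
    rw [binaryMonomial, binaryMonomial, binaryMonomial, mul_mul_mul_comm, ← pow_add, ← pow_add]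
    congr 2 <;> omega

end TransvectantOfMonomials

/-! ### Constructing covariants from bilinear maps -/

section Covariants

variable {k : Type*} [Field k] {V W U Z : Type*} [AddCommGroup V] [Module k V]
  [AddCommGroup W] [Module k W] [AddCommGroup U] [Module k U] [AddCommGroup Z] [Module k Z]

theorem isMorphism_id : IsMorphism k (fun v : V => v) := fun l =>
  Algebra.subset_adjoin ⟨l, rfl⟩

/-- A bilinear map applied to two morphisms is a morphism. -/
theorem IsMorphism.bilinear [Module.Finite k W] {φ : V → W} {χ : V → U} (hφ : IsMorphism k φ)
    (hχ : IsMorphism k χ) (B : W →ₗ[k] U →ₗ[k] Z) : IsMorphism k fun v => B (φ v) (χ v) := by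
  intro l
  let b := Module.finBasis k W
  have h : (fun v => l (B (φ v) (χ v))) =
      ∑ j, (fun v => b.coord j (φ v)) * (fun v => (l ∘ₗ B (b j)) (χ v)) := by
    funext v
    conv_lhs => rw [← b.sum_repr (φ v), map_sum, LinearMap.sum_apply, map_sum]
    simp
  rw [h]
  exact Subalgebra.sum_mem _ fun j _ => Subalgebra.mul_mem _ (hφ _) (hχ _)

variable {G : Type*} [Monoid G] {ρ : Representation k G V} {σ : Representation k G W}
  {τ : Representation k G U} {θ : Representation k G Z}

theorem isHomogeneousCovariant_id : IsHomogeneousCovariant 1 ρ ρ fun v => v where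
  isMorphism := isMorphism_id
  equivariant _ _ := rfl
  homogeneous c v := by rw [pow_one]

/-- An equivariant bilinear map applied to two homogeneous covariants. -/
theorem IsHomogeneousCovariant.bilinear [Module.Finite k W] {m n : ℕ} {φ : V → W} {χ : V → U}
    (hφ : IsHomogeneousCovariant m ρ σ φ) (hχ : IsHomogeneousCovariant n ρ τ χ)
    (B : W →ₗ[k] U →ₗ[k] Z) (hB : ∀ g w u, B (σ g w) (τ g u) = θ g (B w u)) :
    IsHomogeneousCovariant (m + n) ρ θ fun v => B (φ v) (χ v) where
  isMorphism := hφ.isMorphism.bilinear hχ.isMorphism B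
  equivariant g v := by rw [hφ.equivariant, hχ.equivariant, hB]
  homogeneous c v := by
    rw [hφ.homogeneous, hχ.homogeneous, map_smul, map_smul, LinearMap.smul_apply, smul_smul,
      pow_add, mul_comm]

/-- Over an algebraically closed field, a homogeneous map of positive degree which does not vanish
on a line maps it onto a line. -/
theorem image_span_singleton [IsAlgClosed k] {n : ℕ} (hn : 0 < n) {φ : V → W}
    (hφ : ∀ (c : k) (v : V), φ (c • v) = c ^ n • φ v) {v : V} {w : W} {u : k} (hu : u ≠ 0)
    (h : φ v = u • w) :
    φ '' (Submodule.span k {v} : Set V) = (Submodule.span k {w} : Set W) := by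
  ext z
  simp only [Set.mem_image, SetLike.mem_coe, Submodule.mem_span_singleton]
  constructor
  · rintro ⟨_, ⟨c, rfl⟩, rfl⟩
    exact ⟨c ^ n * u, by rw [hφ, h, smul_smul]⟩
  · rintro ⟨a, rfl⟩
    obtain ⟨c, hc⟩ := IsAlgClosed.exists_pow_nat_eq (a / u) hn
    exact ⟨c • v, ⟨c, rfl⟩, by rw [hφ, h, hc, smul_smul, div_mul_cancel₀ _ hu]⟩

end Covariants

/-! ### Equivariant bilinear maps on binary forms -/

section BinaryForms

variable {k : Type*} [Field k]

instance (d : ℕ) : Module.Finite k (BinaryForm k d) :=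
  Module.Finite.iff_fg.mpr (homogeneousSubmodule_fg (Fin 2) k d)

theorem det_inv_eq_one (g : SL(2, k)) :
    ((g⁻¹ : SL(2, k)) : Matrix (Fin 2) (Fin 2) k).det = 1 :=
  (g⁻¹).2

theorem coe_binaryFormRep_apply {d : ℕ} (g : SL(2, k)) (f : BinaryForm k d) :
    (binaryFormRep k d g f : MvPolynomial (Fin 2) k) =
      linSubst k ((g⁻¹ : SL(2, k)) : Matrix (Fin 2) (Fin 2) k) f := rfl

/-- The bilinear map on binary forms induced by a linear map on `k[x, y] ⊗ k[x, y]`, precomposed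
with a power of Cayley's operator. -/
def omegaBilinear {Z : Type*} [AddCommGroup Z] [Module k Z] (p q r : ℕ)
    (T : MvPolynomial (Fin 2) k ⊗[k] MvPolynomial (Fin 2) k →ₗ[k] Z) :
    BinaryForm k p →ₗ[k] BinaryForm k q →ₗ[k] Z :=
  ((TensorProduct.mk k _ _).compr₂ (T ∘ₗ omega k ^ r)).domRestrict₁₂ _ _

theorem omegaBilinear_apply {Z : Type*} [AddCommGroup Z] [Module k Z] (p q r : ℕ)
    (T : MvPolynomial (Fin 2) k ⊗[k] MvPolynomial (Fin 2) k →ₗ[k] Z) (f : BinaryForm k p)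
    (g : BinaryForm k q) :
    omegaBilinear p q r T f g =
      T ((omega k ^ r) ((f : MvPolynomial (Fin 2) k) ⊗ₜ (g : MvPolynomial (Fin 2) k))) := rfl

theorem omegaBilinear_equivariant {Z : Type*} [AddCommGroup Z] [Module k Z] (p q r : ℕ)
    (T : MvPolynomial (Fin 2) k ⊗[k] MvPolynomial (Fin 2) k →ₗ[k] Z)
    (θ : Representation k SL(2, k) Z)
    (hT : ∀ (g : SL(2, k)) (f₁ f₂ : MvPolynomial (Fin 2) k),
      T (linSubst k ((g⁻¹ : SL(2, k)) : Matrix (Fin 2) (Fin 2) k) f₁ ⊗ₜ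
        linSubst k ((g⁻¹ : SL(2, k)) : Matrix (Fin 2) (Fin 2) k) f₂) = θ g (T (f₁ ⊗ₜ f₂)))
    (g : SL(2, k)) (f₁ : BinaryForm k p) (f₂ : BinaryForm k q) :
    omegaBilinear p q r T (binaryFormRep k p g f₁) (binaryFormRep k q g f₂) =
      θ g (omegaBilinear p q r T f₁ f₂) := by
  set σ := (linSubst k ((g⁻¹ : SL(2, k)) : Matrix (Fin 2) (Fin 2) k)).toLinearMap with hσ
  have hT' : T ∘ₗ TensorProduct.map σ σ = θ g ∘ₗ T := TensorProduct.ext' fun x y => hT g x y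
  have h := LinearMap.congr_fun (omega_pow_map_linSubst (det_inv_eq_one g) r)
    ((f₁ : MvPolynomial (Fin 2) k) ⊗ₜ (f₂ : MvPolynomial (Fin 2) k))
  simp only [Module.End.mul_apply, TensorProduct.map_tmul, ← hσ] at h
  simp only [omegaBilinear_apply]
  refine (congrArg T h).trans ?_
  exact LinearMap.congr_fun hT' _

/-- The transvectant of binary forms of fixed degrees. -/
def transvectantForm {p q e : ℕ} (r : ℕ) (h : p - r + (q - r) = e) :
    BinaryForm k p →ₗ[k] BinaryForm k q →ₗ[k] BinaryForm k e :=
  LinearMap.mk₂ k (fun f g => ⟨transvectant r f.1 g.1, by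
      rw [mem_homogeneousSubmodule, ← h]
      exact isHomogeneous_transvectant f.2 g.2 r⟩)
    (fun f f' g => Subtype.ext (by simp)) (fun c f g => Subtype.ext (by simp))
    (fun f g g' => Subtype.ext (by simp)) (fun c f g => Subtype.ext (by simp))

theorem transvectantForm_equivariant {p q e : ℕ} (r : ℕ) (h : p - r + (q - r) = e)
    (g : SL(2, k)) (f₁ : BinaryForm k p) (f₂ : BinaryForm k q) :
    transvectantForm r h (binaryFormRep k p g f₁) (binaryFormRep k q g f₂) =
      binaryFormRep k e g (transvectantForm r h f₁ f₂) :=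
  Subtype.ext (transvectant_linSubst (det_inv_eq_one g) r f₁.1 f₂.1)

end BinaryForms

/-! ### Weight spaces of `V_d` and `sl₂` -/

section WeightSpaces

variable {k : Type*} [Field k]

variable (k) in
/-- The monomial `x ^ a * y ^ b` as a binary form. -/
def binaryMonomialForm {a b d : ℕ} (h : a + b = d) : BinaryForm k d :=
  ⟨binaryMonomial k a b, h ▸ isHomogeneous_binaryMonomial k a b⟩

theorem binaryMonomial_eq_monomial (a b : ℕ) :
    binaryMonomial k a b = monomial (Finsupp.single 0 a + Finsupp.single 1 b) 1 := by
  rw [binaryMonomial, X_pow_eq_monomial, X_pow_eq_monomial, monomial_mul, one_mul]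

theorem binaryMonomial_ne_zero (a b : ℕ) : binaryMonomial k a b ≠ 0 := by
  rw [binaryMonomial_eq_monomial]
  simp

theorem coeff_linSubst_diag (a b : k) (f : MvPolynomial (Fin 2) k) (s : Fin 2 →₀ ℕ) :
    coeff s (linSubst k !![a, 0; 0, b] f) = a ^ s 0 * b ^ s 1 * coeff s f := by
  induction f using MvPolynomial.induction_on' with
  | add f g hf hg => rw [map_add, coeff_add, coeff_add, hf, hg, mul_add]
  | monomial m c =>
    have : linSubst k !![a, 0; 0, b] (monomial m c) = monomial m (a ^ m 0 * b ^ m 1 * c) := by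
      rw [linSubst, aeval_monomial, Finsupp.prod_fintype _ _ (by simp), monomial_eq,
        Finsupp.prod_fintype _ _ (by simp)]
      simp only [Fin.sum_univ_two, Fin.prod_univ_two, algebraMap_eq]
      simp only [Matrix.of_apply, Matrix.cons_val', Matrix.cons_val_zero, Matrix.cons_val_one,
        Matrix.cons_val_fin_one, map_zero, zero_mul, add_zero, zero_add, mul_pow, map_mul, map_pow]
      ring
    rw [this, coeff_monomial, coeff_monomial]
    split_ifs with h
    · rw [h]
    · simp

theorem coe_torus_inv (t : kˣ) : (((torus t)⁻¹ : SL(2, k)) : Matrix (Fin 2) (Fin 2) k) =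
    !![((t⁻¹ : kˣ) : k), 0; 0, (t : k)] := by
  rw [Matrix.SpecialLinearGroup.coe_inv]
  simp [torus, Matrix.adjugate_fin_two]

theorem degree_of_mem_support {d : ℕ} (f : BinaryForm k d) {s : Fin 2 →₀ ℕ}
    (hs : s ∈ f.1.support) : s 0 + s 1 = d := by
  have h := (mem_homogeneousSubmodule d f.1).mp f.2 (mem_support_iff.mp hs)
  have h' : Finsupp.degree s = Finsupp.weight 1 s :=
    DFunLike.congr_fun Finsupp.degree_eq_weight_one s
  rwa [← h', Finsupp.degree_eq_sum, Fin.sum_univ_two] at h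

variable [CharZero k]

theorem mem_weightSpace_binaryFormRep {d i : ℕ} (f : BinaryForm k d) :
    f ∈ weightSpace (binaryFormRep k d) i ↔ ∀ s ∈ f.1.support, s 1 = s 0 + i := by
  have key : ∀ (t : kˣ) (s : Fin 2 →₀ ℕ),
      coeff s (binaryFormRep k d (torus t) f).1 = ((t⁻¹ : kˣ) : k) ^ s 0 * (t : k) ^ s 1 *
        coeff s f.1 := by
    intro t s
    rw [coe_binaryFormRep_apply, coe_torus_inv, coeff_linSubst_diag]
  constructor
  · intro h s hs
    -- The single torus element with `t = 2` separates all weights, since powers of 2 are distinct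
    -- in characteristic zero.
    have h2 : (2 : k) ≠ 0 := two_ne_zero
    have h1 := congrArg (fun f => coeff s f.1) (h (Units.mk0 2 h2))
    simp only [key, Units.val_inv_eq_inv_val, Units.val_mk0, Submodule.coe_smul, coeff_smul,
      smul_eq_mul] at h1
    have h3 := mul_right_cancel₀ (mem_support_iff.mp hs) h1
    have h4 : (2 : k) ^ s 1 = 2 ^ (s 0 + i) := by
      rw [pow_add, ← h3, ← mul_assoc, ← mul_pow, mul_inv_cancel₀ h2, one_pow, one_mul]
    have h5 : (2 : ℕ) ^ s 1 = 2 ^ (s 0 + i) := by exact_mod_cast h4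
    exact Nat.pow_right_injective le_rfl h5
  · intro h t
    refine Subtype.ext (MvPolynomial.ext _ _ fun s => ?_)
    rw [key, Submodule.coe_smul, coeff_smul, smul_eq_mul]
    by_cases hs : s ∈ f.1.support
    · rw [h s hs, pow_add, ← mul_assoc, ← mul_pow, Units.inv_mul, one_pow, one_mul]
    · rw [notMem_support_iff.mp hs, mul_zero, mul_zero]

theorem weightSpace_eq_span {a b d i : ℕ} (h : a + b = d) (hi : b = a + i) :
    weightSpace (binaryFormRep k d) i = Submodule.span k {binaryMonomialForm k h} := by
  refine le_antisymm (fun f hf => ?_) ?_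
  · rw [mem_weightSpace_binaryFormRep] at hf
    refine Submodule.mem_span_singleton.mpr
      ⟨coeff (Finsupp.single 0 a + Finsupp.single 1 b) f.1, Subtype.ext ?_⟩
    refine MvPolynomial.ext _ _ fun s => ?_
    simp only [Submodule.coe_smul, binaryMonomialForm, binaryMonomial_eq_monomial, coeff_smul,
      coeff_monomial, smul_eq_mul]
    split_ifs with hs
    · rw [← hs, mul_one]
    · rw [mul_zero]
      refine (notMem_support_iff.mp fun hs' => hs ?_).symm
      have h1 := hf s hs'
      have h2 := degree_of_mem_support f hs'
      ext j
      fin_cases j <;> simp <;> omega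
  · rw [Submodule.span_singleton_le_iff_mem, mem_weightSpace_binaryFormRep]
    intro s hs
    simp only [binaryMonomialForm, binaryMonomial_eq_monomial] at hs
    have := Finset.mem_singleton.mp (support_monomial_subset hs)
    simp [this, hi]

theorem weightSpace_eq_bot {d i : ℕ} (h : d < i) : weightSpace (binaryFormRep k d) i = ⊥ := by
  rw [eq_bot_iff]
  intro f hf
  rw [mem_weightSpace_binaryFormRep] at hf
  rw [Submodule.mem_bot]
  refine Subtype.ext (support_eq_empty.mp (Finset.eq_empty_of_forall_notMem fun s hs => ?_))
  have h1 := hf s hs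
  have h2 := degree_of_mem_support f hs
  omega

theorem weightSpace_adjointRep_two :
    weightSpace (adjointRep k) 2 = Submodule.span k {sl2E k} := by
  have key : ∀ (t : kˣ) (A : sl2 k), ((adjointRep k (torus t) A : sl2 k) :
      Matrix (Fin 2) (Fin 2) k) = !![(t : k), 0; 0, ((t⁻¹ : kˣ) : k)] *
        (A : Matrix (Fin 2) (Fin 2) k) * !![((t⁻¹ : kˣ) : k), 0; 0, (t : k)] := by
    intro t A
    rw [← coe_torus_inv]
    rfl
  refine le_antisymm (fun A hA => ?_) ?_
  · have h2 : (2 : k) ≠ 0 := two_ne_zero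
    have h := congrArg (fun B : sl2 k => (B : Matrix (Fin 2) (Fin 2) k)) (hA (Units.mk0 2 h2))
    have hsmul : ∀ (c : k) (B : sl2 k), ((c • B : sl2 k) : Matrix (Fin 2) (Fin 2) k) =
      c • (B : Matrix (Fin 2) (Fin 2) k) := fun _ _ => rfl
    simp only [key, hsmul] at h
    have htr : (A : Matrix (Fin 2) (Fin 2) k) 0 0 + (A : Matrix (Fin 2) (Fin 2) k) 1 1 = 0 := by
      have := A.2
      change Matrix.trace (A : Matrix (Fin 2) (Fin 2) k) = 0 at this
      rwa [Matrix.trace_fin_two] at this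
    have h00 := congrFun (congrFun h 0) 0
    have h10 := congrFun (congrFun h 1) 0
    simp only [Matrix.mul_apply, Fin.sum_univ_two, Matrix.of_apply, Matrix.cons_val',
      Matrix.cons_val_zero, Matrix.cons_val_one, Matrix.cons_val_fin_one, Units.val_inv_eq_inv_val,
      Units.val_mk0, Matrix.smul_apply, smul_eq_mul] at h00 h10
    field_simp at h00 h10
    have e00 : (A : Matrix (Fin 2) (Fin 2) k) 0 0 = 0 := by
      have : (3 : k) ≠ 0 := three_ne_zero
      refine (mul_eq_zero.mp (?_ : (3 : k) * _ = 0)).resolve_left this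
      linear_combination -(1 / 2) * h00
    have e10 : (A : Matrix (Fin 2) (Fin 2) k) 1 0 = 0 := by
      have : (15 : k) ≠ 0 := by norm_num
      refine (mul_eq_zero.mp (?_ : (15 : k) * _ = 0)).resolve_left this
      linear_combination -h10
    refine Submodule.mem_span_singleton.mpr ⟨(A : Matrix (Fin 2) (Fin 2) k) 0 1, Subtype.ext ?_⟩
    have e11 : (A : Matrix (Fin 2) (Fin 2) k) 1 1 = 0 := by rw [e00, zero_add] at htr; exact htr
    ext i j
    fin_cases i <;> fin_cases j <;> simp [sl2E, e00, e10, e11]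
  · rw [Submodule.span_singleton_le_iff_mem]
    intro t
    refine Subtype.ext ?_
    rw [key]
    ext i j
    fin_cases i <;> fin_cases j <;> simp [sl2E, Matrix.mul_apply, Fin.sum_univ_two, pow_two]

end WeightSpaces

/-! ### From quadratic forms to `sl₂` -/

section Hessian

variable {k : Type*} [Field k]

variable (k) in
/-- The value at the origin of a second partial derivative. -/
def hessianEntry (i j : Fin 2) : MvPolynomial (Fin 2) k →ₗ[k] k :=
  (aeval (0 : Fin 2 → k)).toLinearMap ∘ₗ partialD k i ∘ₗ partialD k j

theorem hessianEntry_symm (i j : Fin 2) (f : MvPolynomial (Fin 2) k) :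
    hessianEntry k i j f = hessianEntry k j i f :=
  congrArg (aeval (0 : Fin 2 → k)) (LinearMap.congr_fun (partialD_commute (k := k) i j).eq f)

theorem hessianEntry_linSubst (A : Matrix (Fin 2) (Fin 2) k) (i j : Fin 2)
    (f : MvPolynomial (Fin 2) k) :
    hessianEntry k i j (linSubst k A f) = ∑ a, ∑ b, A a i * A b j * hessianEntry k a b f := by
  have h0 : ∀ g, aeval (0 : Fin 2 → k) (linSubst k A g) = aeval (0 : Fin 2 → k) g := by
    intro g
    rw [aeval_eq_eval]
    have := eval_linSubst k A 0 g
    rwa [Matrix.mulVec_zero] at this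
  simp only [hessianEntry, LinearMap.comp_apply, AlgHom.toLinearMap_apply, partialD_linSubst,
    map_smul, map_add, h0, Fin.sum_univ_two, smul_eq_mul]
  ring

variable (k) in
/-- The equivariant linear map from `k[x, y]` to `sl₂` built from the Hessian matrix at the
origin. -/
def hessianSl2 : MvPolynomial (Fin 2) k →ₗ[k] sl2 k where
  toFun f := ⟨!![hessianEntry k 0 1 f, hessianEntry k 1 1 f;
      -hessianEntry k 0 0 f, -hessianEntry k 0 1 f], by
    change Matrix.trace (!![hessianEntry k 0 1 f, hessianEntry k 1 1 f;
      -hessianEntry k 0 0 f, -hessianEntry k 0 1 f] : Matrix (Fin 2) (Fin 2) k) = 0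
    simp [Matrix.trace_fin_two]⟩
  map_add' f g := Subtype.ext (by
    ext i j
    fin_cases i <;> fin_cases j <;> simp <;> ring)
  map_smul' c f := Subtype.ext (by
    ext i j
    fin_cases i <;> fin_cases j <;> simp)

/-- With `J = !![0, 1; -1, 0]` and `H` the Hessian at the origin, the matrix is `J * H`.
Substituting `A = g⁻¹` turns `H` into `Aᵀ * H * A`, and `J * Aᵀ = A⁻¹ * J` when `det A = 1`, which
gives conjugation by `g`. -/
theorem hessianSl2_linSubst (g : SL(2, k)) (f : MvPolynomial (Fin 2) k) :
    hessianSl2 k (linSubst k ((g⁻¹ : SL(2, k)) : Matrix (Fin 2) (Fin 2) k) f) =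
      adjointRep k g (hessianSl2 k f) := by
  refine Subtype.ext ?_
  change (hessianSl2 k _ : Matrix (Fin 2) (Fin 2) k) = (g : Matrix (Fin 2) (Fin 2) k) *
    (hessianSl2 k f : Matrix (Fin 2) (Fin 2) k) * ((g⁻¹ : SL(2, k)) : Matrix (Fin 2) (Fin 2) k)
  simp only [hessianSl2, LinearMap.coe_mk, AddHom.coe_mk, hessianEntry_linSubst,
    Fin.sum_univ_two, hessianEntry_symm 1 0,
    Matrix.SpecialLinearGroup.coe_inv]
  ext i j
  fin_cases i <;> fin_cases j <;>
    simp [Matrix.adjugate_fin_two, Matrix.mul_apply, Fin.sum_univ_two] <;> ring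

theorem hessianSl2_binaryMonomial_zero_two :
    hessianSl2 k (binaryMonomial k 0 2) = (2 : k) • sl2E k := by
  refine Subtype.ext ?_
  ext i j
  fin_cases i <;> fin_cases j <;>
    simp [hessianSl2, hessianEntry, partialD_apply, binaryMonomial, sl2E]
  exact map_ofNat constantCoeff 2

end Hessian

/-! ### Polarization of quadratic morphisms -/

section Polarization

variable {k : Type*} [Field k] {V W : Type*} [AddCommGroup V] [Module k V]
  [AddCommGroup W] [Module k W]

/-- The Taylor expansion of a regular function along lines through the origin, up to second
order. -/
theorem exists_expansion_of_mem_regularFunctions {f : V → k} (hf : f ∈ regularFunctions k V) :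
    ∃ (a : k) (l : Module.Dual k V) (b : V →ₗ[k] V →ₗ[k] k) (P : V → Polynomial k),
      (∀ v c, f (c • v) = (P v).eval c) ∧
      ∀ v, (P v).coeff 0 = a ∧ (P v).coeff 1 = l v ∧ (P v).coeff 2 = b v v := by
  -- The orders zero and one must be carried along: the second coefficient of a product involves
  -- them through `a * b₂ + l * l₂ + a₂ * b`.
  refine Algebra.adjoin_induction (p := fun f _ => ∃ (a : k) (l : Module.Dual k V)
    (b : V →ₗ[k] V →ₗ[k] k) (P : V → Polynomial k), (∀ v c, f (c • v) = (P v).eval c) ∧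
      ∀ v, (P v).coeff 0 = a ∧ (P v).coeff 1 = l v ∧ (P v).coeff 2 = b v v) ?_ ?_ ?_ ?_ hf
  · rintro _ ⟨l, rfl⟩
    refine ⟨0, l, 0, fun v => Polynomial.C (l v) * Polynomial.X, fun v c => ?_, fun v => ?_⟩
    · beta_reduce
      rw [map_smul, smul_eq_mul, Polynomial.eval_mul, Polynomial.eval_C, Polynomial.eval_X,
        mul_comm]
    · simp [Polynomial.coeff_X]
  · intro r
    refine ⟨r, 0, 0, fun v => Polynomial.C r, fun v c => ?_, fun v => ?_⟩
    · simp
    · simp [Polynomial.coeff_C]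
  · rintro f g - - ⟨a, l, b, P, h, h'⟩ ⟨a₂, l₂, b₂, P₂, h₂, h₂'⟩
    refine ⟨a + a₂, l + l₂, b + b₂, fun v => P v + P₂ v, fun v c => ?_, fun v => ?_⟩
    · simp [h, h₂]
    · simp [h', h₂']
  · rintro f g - - ⟨a, l, b, P, h, h'⟩ ⟨a₂, l₂, b₂, P₂, h₂, h₂'⟩
    refine ⟨a * a₂, a • l₂ + a₂ • l,
      a • b₂ + a₂ • b + (LinearMap.mul k k).compl₁₂ l l₂, fun v => P v * P₂ v,
      fun v c => ?_, fun v => ?_⟩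
    · simp [h, h₂]
    · refine ⟨?_, ?_, ?_⟩
      · simp [h', h₂', Polynomial.mul_coeff_zero]
      · simp [h', h₂', Polynomial.mul_coeff_one]
        ring
      · rw [Polynomial.coeff_mul, Finset.Nat.sum_antidiagonal_eq_sum_range_succ_mk]
        simp [Finset.sum_range_succ, h', h₂']
        ring

theorem exists_bilinear_of_mem_regularFunctions [Infinite k] {f : V → k}
    (hf : f ∈ regularFunctions k V) (h2 : ∀ (c : k) (v : V), f (c • v) = c ^ 2 * f v) :
    ∃ b : V →ₗ[k] V →ₗ[k] k, ∀ v, f v = b v v := by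
  obtain ⟨a, l, b, P, hP, hc⟩ := exists_expansion_of_mem_regularFunctions hf
  refine ⟨b, fun v => ?_⟩
  have h : P v = Polynomial.C (f v) * Polynomial.X ^ 2 := by
    refine Polynomial.funext fun c => ?_
    rw [← hP, h2, Polynomial.eval_mul, Polynomial.eval_C, Polynomial.eval_pow, Polynomial.eval_X,
      mul_comm]
  rw [← (hc v).2.2, h]
  simp

/-- The polarization of a quadratic morphism. -/
theorem exists_polarization [Infinite k] {φ : V → W} (hφ : IsMorphism k φ)
    (h2 : ∀ (c : k) (v : V), φ (c • v) = c ^ 2 • φ v) :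
    ∃ B : V →ₗ[k] V →ₗ[k] W, ∀ v w, B v w = φ (v + w) - φ v - φ w := by
  have key : ∀ l : Module.Dual k W, ∃ b : V →ₗ[k] V →ₗ[k] k, ∀ v, l (φ v) = b v v := fun l =>
    exists_bilinear_of_mem_regularFunctions (hφ l) fun c v => by rw [h2, map_smul, smul_eq_mul]
  have ext : ∀ {x y : W}, (∀ l : Module.Dual k W, l x = l y) → x = y := fun {x y} h =>
    sub_eq_zero.mp ((Module.forall_dual_apply_eq_zero_iff k _).mp fun l => by
      rw [map_sub, h, sub_self])
  -- Bilinearity is checked after applying each functional, where the map is the diagonal of a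
  -- bilinear form. Using the polar form itself avoids choices, so it inherits symmetry and
  -- equivariance from `φ`.
  refine ⟨LinearMap.mk₂ k (fun v w => φ (v + w) - φ v - φ w) ?_ ?_ ?_ ?_, fun v w => rfl⟩
  all_goals
    intros
    refine ext fun l => ?_
    obtain ⟨b, hb⟩ := key l
    simp only [map_sub, map_add, map_smul, hb, LinearMap.add_apply, LinearMap.smul_apply,
      smul_eq_mul]
    ring

end Polarization

/-! ### Powers of linear forms -/

section LinearPowers

variable {k : Type*} [Field k]

variable (k) in
/-- The `d`-th power of the linear form `a * x + b * y`. -/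
def linearPower (d : ℕ) (a b : k) : BinaryForm k d :=
  ⟨(C a * X 0 + C b * X 1) ^ d, by
    have h := (((isHomogeneous_C (Fin 2) a).mul (isHomogeneous_X k 0)).add
      ((isHomogeneous_C (Fin 2) b).mul (isHomogeneous_X k 1))).pow d
    rwa [zero_add, one_mul] at h⟩

theorem coe_linearPower (d : ℕ) (a b : k) :
    (linearPower k d a b : MvPolynomial (Fin 2) k) = (C a * X 0 + C b * X 1) ^ d := rfl

theorem linearPower_smul (d : ℕ) (c a b : k) :
    linearPower k d (c * a) (c * b) = c ^ d • linearPower k d a b := by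
  refine Subtype.ext ?_
  rw [Submodule.coe_smul, coe_linearPower, coe_linearPower, smul_eq_C_mul, map_pow, ← mul_pow]
  simp only [map_mul]
  ring

theorem binaryFormRep_linearPower (d : ℕ) (g : SL(2, k)) (a b : k) :
    binaryFormRep k d g (linearPower k d a b) =
      linearPower k d (a * (g⁻¹ : SL(2, k)).1 0 0 + b * (g⁻¹ : SL(2, k)).1 1 0)
        (a * (g⁻¹ : SL(2, k)).1 0 1 + b * (g⁻¹ : SL(2, k)).1 1 1) := by
  refine Subtype.ext ?_
  rw [coe_binaryFormRep_apply, coe_linearPower, coe_linearPower, map_pow]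
  congr 1
  simp only [linSubst, map_add, map_mul, aeval_X, aeval_C, algebraMap_eq, Fin.sum_univ_two]
  ring

theorem binaryFormRep_torus_eq (d : ℕ) (t : kˣ) :
    binaryFormRep k d (torus t) (linearPower k d 1 0) =
        (((t⁻¹ : kˣ) : k) ^ d) • linearPower k d 1 0 ∧
      binaryFormRep k d (torus t) (linearPower k d 0 1) = ((t : k) ^ d) • linearPower k d 0 1 := by
  constructor <;>
    rw [binaryFormRep_linearPower, coe_torus_inv, ← linearPower_smul] <;> simp

theorem coe_binaryForm_mem_span {d : ℕ} (f : BinaryForm k d) :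
    (f : MvPolynomial (Fin 2) k) ∈
      Submodule.span k (Set.range fun j : Fin (d + 1) => binaryMonomial k (d - j) j) := by
  rw [f.1.as_sum]
  refine Submodule.sum_mem _ fun s hs => ?_
  have hd := degree_of_mem_support f hs
  have h : monomial s (coeff s f.1) = coeff s f.1 • binaryMonomial k (d - s 1) (s 1) := by
    rw [binaryMonomial_eq_monomial, smul_monomial, smul_eq_mul, mul_one]
    have hs' : s = Finsupp.single 0 (d - s 1) + Finsupp.single 1 (s 1) := by
      ext j
      fin_cases j
      · simp
        omega
      · simp
    exact congrArg (fun s' => monomial s' (coeff s f.1)) hs'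
  rw [h]
  exact Submodule.smul_mem _ _ (Submodule.subset_span ⟨⟨s 1, by omega⟩, rfl⟩)

variable [CharZero k]

/-- The powers of infinitely many linear forms `x + t * y` span the space of binary forms. -/
theorem eq_zero_of_apply_linearPower {d : ℕ} (l : Module.Dual k (BinaryForm k d))
    (h : {t : k | l (linearPower k d 1 t) = 0}.Infinite) : l = 0 := by
  obtain ⟨l', rfl⟩ := LinearMap.exists_extend l
  -- The functional along `(x + t * y) ^ d` is a polynomial in `t` whose coefficients are its values
  -- on monomials times binomial coefficients, which are invertible in characteristic zero.
  have hpoly : ∀ t : k, l' (linearPower k d 1 t).1 =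
      (∑ j ∈ Finset.range (d + 1), Polynomial.C ((d.choose j : k) *
        l' (binaryMonomial k (d - j) j)) * Polynomial.X ^ j).eval t := by
    intro t
    rw [coe_linearPower, add_comm, add_pow, map_sum, Polynomial.eval_finsetSum]
    refine Finset.sum_congr rfl fun j _ => ?_
    have : ((C t * X 1) ^ j * (C 1 * X 0) ^ (d - j) * (d.choose j : MvPolynomial (Fin 2) k)) =
        (t ^ j * (d.choose j : k)) • binaryMonomial k (d - j) j := by
      rw [binaryMonomial, smul_eq_C_mul]
      simp only [map_one, one_mul, mul_pow, map_mul, map_pow, map_natCast]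
      ring
    rw [this, map_smul]
    simp only [smul_eq_mul, Polynomial.eval_mul, Polynomial.eval_C, Polynomial.eval_pow,
      Polynomial.eval_X]
    ring
  have hzero := Polynomial.eq_zero_of_infinite_isRoot _ (h.mono fun t ht => by
    have ht' : l' (linearPower k d 1 t).1 = 0 := ht
    rw [hpoly] at ht'
    exact ht')
  refine LinearMap.ext fun f => ?_
  refine Submodule.span_induction (p := fun g _ => l' g = 0) ?_ (map_zero _) ?_ ?_
    (coe_binaryForm_mem_span f)
  · rintro _ ⟨j, rfl⟩
    have hj := congrArg (fun p => Polynomial.coeff p j) hzero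
    simp only [Polynomial.finsetSum_coeff, Polynomial.coeff_C_mul, Polynomial.coeff_X_pow,
      mul_ite, mul_one, mul_zero, Finset.sum_ite_eq, Finset.mem_range, j.2, if_true,
      Polynomial.coeff_zero] at hj
    exact (mul_eq_zero.mp hj).resolve_left
      (Nat.cast_ne_zero.mpr (Nat.choose_pos (Nat.le_of_lt_succ j.2)).ne')
  · intro x y _ _ hx hy
    rw [map_add, hx, hy, add_zero]
  · intro c x _ hx
    rw [map_smul, hx, smul_zero]

end LinearPowers

/-! ### No quadratic covariants for `d ≡ 2 mod 4` -/

section Uniqueness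

variable {k : Type*} [Field k] [CharZero k]

/-- A symmetric equivariant bilinear map `V_d × V_d → V_d` vanishes on `(x ^ d, y ^ d)` when
`d ≡ 2 mod 4`. -/
theorem symmetric_bilinear_apply_linearPower {d m : ℕ} (hd : m + m = d) (hm : Odd m)
    (B : BinaryForm k d →ₗ[k] BinaryForm k d →ₗ[k] BinaryForm k d) (hsymm : ∀ v w, B v w = B w v)
    (hB : ∀ g v w, B (binaryFormRep k d g v) (binaryFormRep k d g w) =
      binaryFormRep k d g (B v w)) :
    B (linearPower k d 1 0) (linearPower k d 0 1) = 0 := by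
  have hmem : B (linearPower k d 1 0) (linearPower k d 0 1) ∈
      weightSpace (binaryFormRep k d) 0 := by
    intro t
    obtain ⟨h1, h2⟩ := binaryFormRep_torus_eq (k := k) d t
    rw [← hB, h1, h2, map_smul, LinearMap.map_smul₂, smul_smul, ← mul_pow, Units.mul_inv, one_pow,
      one_smul, pow_zero, one_smul]
  rw [weightSpace_eq_span hd rfl] at hmem
  obtain ⟨c, hc⟩ := Submodule.mem_span_singleton.mp hmem
  -- The Weyl element. Its inverse is the one applied below, so that the substitution is `x ↦ y`, `y
  -- ↦ -x`.
  let g : SL(2, k) := ⟨!![0, 1; -1, 0], by simp [Matrix.det_fin_two]⟩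
  have heven : Even d := ⟨m, hd.symm⟩
  have hg1 : binaryFormRep k d g⁻¹ (linearPower k d 1 0) = linearPower k d 0 1 := by
    rw [binaryFormRep_linearPower, inv_inv]
    simp [g]
  have hg2 : binaryFormRep k d g⁻¹ (linearPower k d 0 1) = linearPower k d 1 0 := by
    rw [binaryFormRep_linearPower, inv_inv]
    have := linearPower_smul (k := k) d (-1) 1 0
    rw [heven.neg_one_pow, one_smul] at this
    rw [← this]
    simp [g]
  have hgm : binaryFormRep k d g⁻¹ (binaryMonomialForm k hd) = -binaryMonomialForm k hd := by
    refine Subtype.ext ?_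
    rw [coe_binaryFormRep_apply, inv_inv]
    simp only [binaryMonomialForm, binaryMonomial, NegMemClass.coe_neg, map_mul, map_pow, linSubst,
      aeval_X, Fin.sum_univ_two]
    simp [g, hm.neg_pow, mul_comm]
  have h := hB g⁻¹ (linearPower k d 1 0) (linearPower k d 0 1)
  rw [hg1, hg2, hsymm, ← hc, map_smul, hgm, smul_neg] at h
  rw [eq_neg_iff_add_eq_zero, ← two_smul k] at h
  rw [← hc]
  exact (smul_eq_zero.mp h).resolve_left two_ne_zero

/-- `SL₂` carries `x, y` to any two independent linear forms up to scaling, so the vanishing at `(x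
^ d, y ^ d)` spreads to pairs of powers, which span in each argument. -/
theorem symmetric_bilinear_eq_zero {d m : ℕ} (hd : m + m = d) (hm : Odd m)
    (B : BinaryForm k d →ₗ[k] BinaryForm k d →ₗ[k] BinaryForm k d) (hsymm : ∀ v w, B v w = B w v)
    (hB : ∀ g v w, B (binaryFormRep k d g v) (binaryFormRep k d g w) =
      binaryFormRep k d g (B v w)) : B = 0 := by
  have h0 := symmetric_bilinear_apply_linearPower hd hm B hsymm hB
  have hst : ∀ s t : k, t ≠ s → B (linearPower k d 1 s) (linearPower k d 1 t) = 0 := by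
    intro s t hne
    have hts : t - s ≠ 0 := sub_ne_zero.mpr hne
    -- The rows are `x + s * y` and `x + t * y`, the second divided by `t - s` to make the
    -- determinant 1.
    let g : SL(2, k) := ⟨!![1, s; (t - s)⁻¹, (t - s)⁻¹ * t], by
      rw [Matrix.det_fin_two_of]
      field_simp⟩
    have h := hB g⁻¹ (linearPower k d 1 0) (linearPower k d 0 1)
    have hg1 : binaryFormRep k d g⁻¹ (linearPower k d 1 0) = linearPower k d 1 s := by
      rw [binaryFormRep_linearPower, inv_inv]
      simp [g]
    have hg2 : binaryFormRep k d g⁻¹ (linearPower k d 0 1) =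
        (t - s)⁻¹ ^ d • linearPower k d 1 t := by
      rw [binaryFormRep_linearPower, inv_inv, ← linearPower_smul]
      simp [g]
    rw [hg1, hg2, h0, map_zero, map_smul] at h
    exact (smul_eq_zero.mp h).resolve_left (pow_ne_zero _ (inv_ne_zero hts))
  have hs : ∀ s : k, B (linearPower k d 1 s) = 0 := by
    intro s
    refine LinearMap.ext fun v => (Module.forall_dual_apply_eq_zero_iff k _).mp fun l => ?_
    refine LinearMap.congr_fun (eq_zero_of_apply_linearPower (l ∘ₗ B (linearPower k d 1 s)) ?_) v
    refine (Set.finite_singleton s).infinite_compl.mono fun t ht => ?_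
    change l (B _ _) = 0
    rw [hst s t ht, map_zero]
  refine LinearMap.ext fun v => LinearMap.ext fun w =>
    (Module.forall_dual_apply_eq_zero_iff k _).mp fun l => ?_
  refine LinearMap.congr_fun (eq_zero_of_apply_linearPower (l ∘ₗ B.flip w) ?_) v
  refine Set.infinite_univ.mono fun t _ => ?_
  change l (B _ _) = 0
  rw [hs t, LinearMap.zero_apply, map_zero]

theorem quadratic_covariant_eq_zero {d m : ℕ} (hd : m + m = d) (hm : Odd m)
    {ψ : BinaryForm k d → BinaryForm k d}
    (hψ : IsHomogeneousCovariant 2 (binaryFormRep k d) (binaryFormRep k d) ψ) : ψ = 0 := by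
  obtain ⟨B, hB⟩ := exists_polarization hψ.isMorphism hψ.homogeneous
  have hB0 : B = 0 := by
    refine symmetric_bilinear_eq_zero hd hm B (fun v w => ?_) fun g v w => ?_
    · rw [hB, hB, add_comm, sub_right_comm]
    · rw [hB, hB, ← map_add, hψ.equivariant, hψ.equivariant, hψ.equivariant, map_sub, map_sub]
  funext v
  have h := hB v v
  -- `B v v = ψ (2 v) - 2 ψ v = 2 ψ v`.
  rw [hB0, ← two_smul k v, hψ.homogeneous, LinearMap.zero_apply, LinearMap.zero_apply] at h
  have h' : (2 : k) • ψ v = 0 := by rw [h]; module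
  exact (smul_eq_zero.mp h').resolve_left two_ne_zero

end Uniqueness

/-! ### The four families of covariants -/

section Existence

variable (k : Type*) [Field k] [IsAlgClosed k] [CharZero k]

theorem exists_quadratic_covariant_sl2 {d : ℕ} (hd : Odd d) :
    ∃ φ : BinaryForm k d → sl2 k,
      IsHomogeneousCovariant 2 (binaryFormRep k d) (adjointRep k) φ ∧
      φ '' (weightSpace (binaryFormRep k d) 1 : Set _) =
        (weightSpace (adjointRep k) 2 : Set _) := by
  obtain ⟨m, hm⟩ := hd
  have hdeg : m + (m + 1) = d := by omega
  let T := hessianSl2 k ∘ₗ LinearMap.mul' k (MvPolynomial (Fin 2) k)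
  have hcov : IsHomogeneousCovariant 2 (binaryFormRep k d) (adjointRep k)
      (fun f => omegaBilinear d d (2 * m) T f f) := by
    refine isHomogeneousCovariant_id.bilinear (m := 1) (n := 1) isHomogeneousCovariant_id _
      (omegaBilinear_equivariant d d (2 * m) T _ fun g f₁ f₂ => ?_)
    simp only [T, LinearMap.comp_apply, LinearMap.mul'_apply, ← map_mul, hessianSl2_linSubst]
  refine ⟨_, hcov, ?_⟩
  rw [weightSpace_eq_span hdeg rfl, weightSpace_adjointRep_two]
  obtain ⟨u, hu, h⟩ := transvectant_binaryMonomial_self (k := k) (le_refl m) (Nat.le_succ m)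
  refine image_span_singleton two_pos hcov.homogeneous (mul_ne_zero hu two_ne_zero) ?_
  change hessianSl2 k (transvectant (2 * m) (binaryMonomial k m (m + 1))
    (binaryMonomial k m (m + 1))) = _
  have e : 2 * (m + 1) - 2 * m = 2 := by omega
  rw [h, Nat.sub_self, e, map_smul, hessianSl2_binaryMonomial_zero_two, smul_smul]

-- No cancellation can occur: `x ^ n` is differentiated `i` times in one factor and `2 * n - i`
-- times in the other, so only `i = n` contributes.
variable {k} in
omit [IsAlgClosed k] in
theorem omega_pow_binaryMonomial_self (n : ℕ) :
    ∃ u : k, u ≠ 0 ∧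
      (omega k ^ (2 * n)) (binaryMonomial k n (n + 2) ⊗ₜ binaryMonomial k n (n + 2)) =
        u • (binaryMonomial k 0 2 ⊗ₜ[k] binaryMonomial k 0 2) := by
  have e : 2 * n - n = n := by omega
  refine ⟨(-1) ^ n * ((2 * n).choose n : k) *
    ((n.descFactorial n : k) * ((n + 2).descFactorial n : k) *
      ((n.descFactorial n : k) * ((n + 2).descFactorial n : k))), ?_, ?_⟩
  · have h1 := (Nat.choose_pos (n := 2 * n) (k := n) (by omega)).ne'
    have h2 := (Nat.descFactorial_pos.mpr (le_refl n)).ne'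
    have h3 := (Nat.descFactorial_pos.mpr (show n ≤ n + 2 by omega)).ne'
    have h4 : ((-1 : k) ^ n) ≠ 0 := pow_ne_zero _ (neg_ne_zero.mpr one_ne_zero)
    simp only [ne_eq, mul_eq_zero, Nat.cast_eq_zero, h1, h2, h3, h4, or_self, not_false_eq_true]
  · rw [omega_pow_tmul, Finset.sum_eq_single n]
    · rw [e, partialD_mul_binaryMonomial, TensorProduct.smul_tmul_smul, smul_smul, Nat.sub_self,
        Nat.add_sub_cancel_left]
    · intro i _ hi
      rw [partialD_mul_binaryMonomial, partialD_mul_binaryMonomial]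
      rcases lt_or_gt_of_ne hi with h | h
      · simp [Nat.descFactorial_of_lt (show n < 2 * n - i by omega)]
      · simp [Nat.descFactorial_of_lt h]
    · intro h
      exact absurd (Finset.mem_range.mpr (by omega)) h

theorem exists_quadratic_covariant_sl2_tensor {d : ℕ} (hd : Even d) (h2 : 2 ≤ d) :
    ∃ φ : BinaryForm k d → sl2 k ⊗[k] sl2 k,
      IsHomogeneousCovariant 2 (binaryFormRep k d) ((adjointRep k).tprod (adjointRep k)) φ ∧
      φ '' (weightSpace (binaryFormRep k d) 2 : Set _) =
        (LinearMap.range (TensorProduct.mapIncl (weightSpace (adjointRep k) 2)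
          (weightSpace (adjointRep k) 2)) : Set _) := by
  obtain ⟨n, hn⟩ : ∃ n, n + (n + 2) = d := by
    obtain ⟨m, hm⟩ := hd
    exact ⟨m - 1, by omega⟩
  let T := TensorProduct.map (hessianSl2 k) (hessianSl2 k)
  have hcov : IsHomogeneousCovariant 2 (binaryFormRep k d)
      ((adjointRep k).tprod (adjointRep k)) (fun f => omegaBilinear d d (2 * n) T f f) := by
    refine isHomogeneousCovariant_id.bilinear (m := 1) (n := 1) isHomogeneousCovariant_id _
      (omegaBilinear_equivariant d d (2 * n) T _ fun g f₁ f₂ => ?_)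
    simp only [T, TensorProduct.map_tmul, hessianSl2_linSubst, Representation.tprod_apply]
  have hrange : LinearMap.range (TensorProduct.mapIncl (weightSpace (adjointRep k) 2)
      (weightSpace (adjointRep k) 2)) = Submodule.span k {sl2E k ⊗ₜ[k] sl2E k} := by
    rw [TensorProduct.range_mapIncl, weightSpace_adjointRep_two, Submodule.map₂_span_span,
      Set.image2_singleton]
    rfl
  refine ⟨_, hcov, ?_⟩
  rw [weightSpace_eq_span hn rfl, hrange]
  obtain ⟨u, hu, h⟩ := omega_pow_binaryMonomial_self (k := k) n
  refine image_span_singleton two_pos hcov.homogeneous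
    (mul_ne_zero hu (mul_ne_zero two_ne_zero two_ne_zero)) ?_
  change T ((omega k ^ (2 * n)) (binaryMonomial k n (n + 2) ⊗ₜ binaryMonomial k n (n + 2))) = _
  rw [h, map_smul, TensorProduct.map_tmul, hessianSl2_binaryMonomial_zero_two,
    TensorProduct.smul_tmul_smul, smul_smul]

theorem exists_quadratic_covariant_binaryForm {d : ℕ} (hd : d ≡ 0 [MOD 4]) :
    ∃ ψ : BinaryForm k d → BinaryForm k d,
      IsHomogeneousCovariant 2 (binaryFormRep k d) (binaryFormRep k d) ψ ∧ ψ ≠ 0 ∧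
      ψ '' (weightSpace (binaryFormRep k d) 2 : Set _) =
        (weightSpace (binaryFormRep k d) 4 : Set _) := by
  obtain ⟨s, hs⟩ := (Nat.modEq_zero_iff_dvd.mp hd)
  have hr : d - 2 * s + (d - 2 * s) = d := by omega
  have hcov : IsHomogeneousCovariant 2 (binaryFormRep k d) (binaryFormRep k d)
      (fun f => transvectantForm (2 * s) hr f f) :=
    isHomogeneousCovariant_id.bilinear (m := 1) (n := 1) isHomogeneousCovariant_id _
      (transvectantForm_equivariant (2 * s) hr)
  refine ⟨_, hcov, fun h0 => ?_, ?_⟩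
  -- The weight zero monomial shows that the covariant is nonzero also for `d = 0`, where both
  -- weight spaces in the image statement are trivial.
  · have hdeg : 2 * s + 2 * s = d := by omega
    have h1 := congrArg Subtype.val (congrFun h0 (binaryMonomialForm k hdeg))
    obtain ⟨u, hu, h⟩ := transvectant_binaryMonomial_self (k := k) (show s ≤ 2 * s by omega)
      (show s ≤ 2 * s by omega)
    exact smul_ne_zero hu (binaryMonomial_ne_zero _ _) (h.symm.trans h1)
  · rcases Nat.eq_zero_or_pos s with h0 | hpos
    · rw [weightSpace_eq_bot (by omega), weightSpace_eq_bot (by omega)]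
      simp
    · have hdeg : (2 * s - 1) + (2 * s + 1) = d := by omega
      have hdeg' : (2 * (2 * s - 1) - 2 * s) + (2 * (2 * s + 1) - 2 * s) = d := by omega
      rw [weightSpace_eq_span hdeg (by omega), weightSpace_eq_span hdeg' (by omega)]
      obtain ⟨u, hu, h⟩ := transvectant_binaryMonomial_self (k := k)
        (show s ≤ 2 * s - 1 by omega) (show s ≤ 2 * s + 1 by omega)
      exact image_span_singleton two_pos hcov.homogeneous hu (Subtype.ext h)

variable {k} in
omit [IsAlgClosed k] [CharZero k] in
theorem transvectant_one_binaryMonomial (a b c : ℕ) :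
    transvectant 1 (binaryMonomial k a b) (binaryMonomial k 0 c) =
      ((a : k) * c) • binaryMonomial k (a - 1) (b + (c - 1)) := by
  rw [transvectant_apply, Finset.sum_range_succ, Finset.sum_range_one,
    partialD_mul_binaryMonomial, partialD_mul_binaryMonomial, partialD_mul_binaryMonomial,
    partialD_mul_binaryMonomial]
  simp only [Nat.sub_zero, Nat.sub_self, Nat.descFactorial_one, Nat.descFactorial_zero,
    Nat.cast_zero, Nat.cast_one, mul_zero, zero_smul, smul_zero, zero_add, mul_one,
    one_mul, pow_zero, Nat.choose_self, one_smul, smul_mul_smul_comm]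
  congr 1
  simp only [binaryMonomial, pow_add]
  ring

theorem exists_quartic_covariant_binaryForm {d : ℕ} (hd : d ≡ 2 [MOD 4]) (h10 : 10 ≤ d) :
    ∃ ψ : BinaryForm k d → BinaryForm k d,
      IsHomogeneousCovariant 4 (binaryFormRep k d) (binaryFormRep k d) ψ ∧
      ψ '' (weightSpace (binaryFormRep k d) 2 : Set _) =
        (weightSpace (binaryFormRep k d) 8 : Set _) := by
  obtain ⟨n, hn⟩ : ∃ n, d = 4 * n + 2 := ⟨d / 4, by have : d % 4 = 2 := hd; omega⟩
  have hr₁ : d - 2 * (n + 1) + (d - 2 * (n + 1)) = 4 * n := by omega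
  have hr₂ : d - 2 * (2 * n) + (d - 2 * (2 * n)) = 4 := by omega
  have hr₃ : 4 * n - 1 + (4 - 1) = d := by omega
  have hcov₁ : IsHomogeneousCovariant 2 (binaryFormRep k d) (binaryFormRep k (4 * n))
      (fun f => transvectantForm (2 * (n + 1)) hr₁ f f) :=
    isHomogeneousCovariant_id.bilinear (m := 1) (n := 1) isHomogeneousCovariant_id _
      (transvectantForm_equivariant _ hr₁)
  have hcov₂ : IsHomogeneousCovariant 2 (binaryFormRep k d) (binaryFormRep k 4)
      (fun f => transvectantForm (2 * (2 * n)) hr₂ f f) :=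
    isHomogeneousCovariant_id.bilinear (m := 1) (n := 1) isHomogeneousCovariant_id _
      (transvectantForm_equivariant _ hr₂)
  have hcov := hcov₁.bilinear (m := 2) (n := 2) hcov₂ _ (transvectantForm_equivariant 1 hr₃)
  refine ⟨_, hcov, ?_⟩
  have hdeg : 2 * n + (2 * n + 2) = d := by omega
  have hdeg' : (2 * n - 3) + (2 * n + 5) = d := by omega
  rw [weightSpace_eq_span hdeg (by omega), weightSpace_eq_span hdeg' (by omega)]
  obtain ⟨u, hu, h⟩ := transvectant_binaryMonomial_self (k := k)
    (show n + 1 ≤ 2 * n by omega) (show n + 1 ≤ 2 * n + 2 by omega)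
  obtain ⟨u', hu', h'⟩ := transvectant_binaryMonomial_self (k := k)
    (le_refl (2 * n)) (show 2 * n ≤ 2 * n + 2 by omega)
  have e₁ : 2 * (2 * n) - 2 * (n + 1) = 2 * n - 2 := by omega
  have e₂ : 2 * (2 * n + 2) - 2 * (n + 1) = 2 * n + 2 := by omega
  have e₃ : 2 * (2 * n + 2) - 2 * (2 * n) = 4 := by omega
  -- The Jacobian of `x ^ (2n-2) * y ^ (2n+2)` and `y ^ 4` has the factor `(2n - 2) * 4`; it is
  -- nonzero because `d ≥ 10` means `n ≥ 2`.
  have hv : ((2 * n - 2 : ℕ) : k) * ((4 : ℕ) : k) ≠ 0 :=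
    mul_ne_zero (Nat.cast_ne_zero.mpr (by omega)) (Nat.cast_ne_zero.mpr (by omega))
  refine image_span_singleton four_pos hcov.homogeneous
    (mul_ne_zero (mul_ne_zero hu hu') hv) (Subtype.ext ?_)
  change transvectant 1
    (transvectant (2 * (n + 1)) (binaryMonomial k (2 * n) (2 * n + 2))
      (binaryMonomial k (2 * n) (2 * n + 2)))
    (transvectant (2 * (2 * n)) (binaryMonomial k (2 * n) (2 * n + 2))
      (binaryMonomial k (2 * n) (2 * n + 2))) = _ • binaryMonomial k (2 * n - 3) (2 * n + 5)
  rw [h, h', e₁, e₂, e₃, Nat.sub_self, map_smul, LinearMap.map_smul₂,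
    transvectant_one_binaryMonomial, smul_smul, smul_smul, Nat.sub_sub]
  congr 1
  ring

end Existence

end SL2Covariants

end

theorem mainTheorem12 (k : Type*) [Field k] [IsAlgClosed k] [CharZero k] (d : ℕ) :
    (Odd d →
      ∃ φ₀ : SL2Covariants.BinaryForm k d → SL2Covariants.sl2 k,
        SL2Covariants.IsHomogeneousCovariant 2 (SL2Covariants.binaryFormRep k d)
          (SL2Covariants.adjointRep k) φ₀ ∧
        φ₀ '' (SL2Covariants.weightSpace (SL2Covariants.binaryFormRep k d) 1 : Set _) =
          (SL2Covariants.weightSpace (SL2Covariants.adjointRep k) 2 : Set _) ∧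
        SL2Covariants.weightSpace (SL2Covariants.adjointRep k) 2 =
          Submodule.span k {SL2Covariants.sl2E k}) ∧
    (Even d → 2 ≤ d →
      ∃ φ₀ : SL2Covariants.BinaryForm k d → SL2Covariants.sl2 k ⊗[k] SL2Covariants.sl2 k,
        SL2Covariants.IsHomogeneousCovariant 2 (SL2Covariants.binaryFormRep k d)
          ((SL2Covariants.adjointRep k).tprod (SL2Covariants.adjointRep k)) φ₀ ∧
        φ₀ '' (SL2Covariants.weightSpace (SL2Covariants.binaryFormRep k d) 2 : Set _) =
          (LinearMap.range (TensorProduct.mapIncl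
            (SL2Covariants.weightSpace (SL2Covariants.adjointRep k) 2)
            (SL2Covariants.weightSpace (SL2Covariants.adjointRep k) 2)) : Set _)) ∧
    (d ≡ 0 [MOD 4] →
      ∃ ψ : SL2Covariants.BinaryForm k d → SL2Covariants.BinaryForm k d,
        SL2Covariants.IsHomogeneousCovariant 2 (SL2Covariants.binaryFormRep k d)
          (SL2Covariants.binaryFormRep k d) ψ ∧
        ψ ≠ 0 ∧
        ψ '' (SL2Covariants.weightSpace (SL2Covariants.binaryFormRep k d) 2 : Set _) =
          (SL2Covariants.weightSpace (SL2Covariants.binaryFormRep k d) 4 : Set _)) ∧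
    (d ≡ 2 [MOD 4] → 10 ≤ d →
      (∃ ψ : SL2Covariants.BinaryForm k d → SL2Covariants.BinaryForm k d,
        SL2Covariants.IsHomogeneousCovariant 4 (SL2Covariants.binaryFormRep k d)
          (SL2Covariants.binaryFormRep k d) ψ ∧
        ψ '' (SL2Covariants.weightSpace (SL2Covariants.binaryFormRep k d) 2 : Set _) =
          (SL2Covariants.weightSpace (SL2Covariants.binaryFormRep k d) 8 : Set _)) ∧
      ¬ ∃ ψ : SL2Covariants.BinaryForm k d → SL2Covariants.BinaryForm k d,
        SL2Covariants.IsHomogeneousCovariant 2 (SL2Covariants.binaryFormRep k d)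
          (SL2Covariants.binaryFormRep k d) ψ ∧ ψ ≠ 0) := by
  refine ⟨fun hd => ?_, SL2Covariants.exists_quadratic_covariant_sl2_tensor k,
    SL2Covariants.exists_quadratic_covariant_binaryForm k, fun hd h10 =>
    ⟨SL2Covariants.exists_quartic_covariant_binaryForm k hd h10, ?_⟩⟩
  · obtain ⟨φ, h1, h2⟩ := SL2Covariants.exists_quadratic_covariant_sl2 k hd
    exact ⟨φ, h1, h2, SL2Covariants.weightSpace_adjointRep_two⟩
  · rintro ⟨ψ, hψ, hne⟩
    have hd' : d % 4 = 2 := hd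
    exact hne (SL2Covariants.quadratic_covariant_eq_zero (m := d / 2) (by omega)
      (Nat.odd_iff.mpr (by omega)) hψ)
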